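/- For integers $n,k\ge 0$, a vector $x\in\mathbb{R}^n$, a radius $\epsilon>0$, biases $b_1\in\mathbb{R}^k$, $b_2\in\mathbb{R}$ and weights $A_1\in\mathbb{R}^{k\times n}$, $a_2\in\mathbb{R}^k$, let $$g(z)=a_2^\top\max(A_1z+b_1,0)+b_2\qquad(z\in\mathbb{R}^n),$$ with the maximum taken entrywise, and let $B=[x-\epsilon\mathbf 1_n,\,x+\epsilon\mathbf 1_n]$ be the $\ell_\infty$ box. The true bounds are $$L_{\mathrm{true}}=\min_{z\in B}g(z),\qquad U_{\mathrm{true}}=\max_{z\in B}g(z).$$ With $u_1=A_1x+b_1+\epsilon|A_1|\mathbf 1_n$ and $M=\mathrm{diag}(\mathbb 1\{u_1\ge 0\})$ (absolute value and indicator entrywise), the proposed bounds are $$L_M=a_2^\top MA_1x+a_2^\top Mb_1+b_2-\epsilon\,|a_2^\top MA_1|\mathbf 1_n,\qquad U_M=a_2^\top MA_1x+a_2^\top Mb_1+b_2+\epsilon\,|a_2^\top MA_1|\mathbf 1_n.$$ Let all entries of $A_1$ and $a_2$ be independent, those of $A_1$ distributed as $\mathcal N(0,\sigma_{A}^2)$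 and those of $a_2$ as $\mathcal N(0,\sigma_{a}^2)$, where $\sigma_A,\sigma_a>0$, and let $\tilde x$ be uniformly distributed on $B$ and independent of $(A_1,a_2)$. Key Assumption (for given $n,k,\sigma_A,\sigma_a,x,\epsilon,b_1,b_2$): there is $m>0$ such that $$\mathbb E_{A_1,a_2}[L_{\mathrm{true}}]\ \ge\ \mathbb E_{A_1,a_2,\tilde x}[g(\tilde x)]-m\sqrt{\mathrm{Var}_{A_1,a_2,\tilde x}[g(\tilde x)]},$$ $$\mathbb E_{A_1,a_2}[U_{\mathrm{true}}]\ \le\ \mathbb E_{A_1,a_2,\tilde x}[g(\tilde x)]+m\sqrt{\mathrm{Var}_{A_1,a_2,\tilde x}[g(\tilde x)]}.$$ Theorem (True Bounds in Expectation). There is $N\in\mathbb{N}$ such that for every input dimension $n\ge N$ and all $k,\sigma_A,\sigma_a,x,\epsilon,b_1,b_2$ as above for which the Key Assumption holds, the random variables $L_M,L_{\mathrm{true}},U_{\mathrm{true}},U_M$ are integrable and $$\mathbb E_{A_1,a_2}[L_M]\le\mathbb E_{A_1,a_2}[L_{\mathrm{true}}]\qquad\text{and}\qquad \mathbb E_{A_1,a_2}[U_{\mathrm{true}}]\le\mathbb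 E_{A_1,a_2}[U_M].$$ -/

import Mathlib

open MeasureTheory ProbabilityTheory
open scoped NNReal Matrix

namespace ReLUBlock

noncomputable section

/-- The `ℓ∞` box `[x - ε 1, x + ε 1]` in `ℝⁿ` (for the coordinatewise order). -/
def box {n : ℕ} (x : Fin n → ℝ) (ε : ℝ) : Set (Fin n → ℝ) :=
  Set.Icc (fun j => x j - ε) (fun j => x j + ε)

/-- The Affine-ReLU-Affine block `g(z) = a₂ᵀ max(A₁ z + b₁, 0) + b₂`. -/
def g {n k : ℕ} (A₁ : Matrix (Fin k) (Fin n) ℝ) (b₁ : Fin k → ℝ) (a₂ : Fin k → ℝ) (b₂ : ℝ)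
    (z : Fin n → ℝ) : ℝ :=
  a₂ ⬝ᵥ (fun i => max ((A₁ *ᵥ z + b₁) i) 0) + b₂

/-- The true lower bound: the smallest value of `g` on the box. -/
def Ltrue {n k : ℕ} (x : Fin n → ℝ) (ε : ℝ) (b₁ : Fin k → ℝ) (b₂ : ℝ)
    (A₁ : Matrix (Fin k) (Fin n) ℝ) (a₂ : Fin k → ℝ) : ℝ :=
  sInf (g A₁ b₁ a₂ b₂ '' box x ε)

/-- The true upper bound: the largest value of `g` on the box. -/
def Utrue {n k : ℕ} (x : Fin n → ℝ) (ε : ℝ) (b₁ : Fin k → ℝ) (b₂ : ℝ)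
    (A₁ : Matrix (Fin k) (Fin n) ℝ) (a₂ : Fin k → ℝ) : ℝ :=
  sSup (g A₁ b₁ a₂ b₂ '' box x ε)

/-- The upper interval bound `u₁ = A₁ x + b₁ + ε |A₁| 1` of the first affine layer. -/
def u₁ {n k : ℕ} (x : Fin n → ℝ) (ε : ℝ) (b₁ : Fin k → ℝ)
    (A₁ : Matrix (Fin k) (Fin n) ℝ) : Fin k → ℝ :=
  A₁ *ᵥ x + b₁ + ε • ((A₁.map fun t => |t|) *ᵥ fun _ => 1)

/-- The diagonal matrix `M = diag(1{u₁ ≥ 0})`. -/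
def M {n k : ℕ} (x : Fin n → ℝ) (ε : ℝ) (b₁ : Fin k → ℝ)
    (A₁ : Matrix (Fin k) (Fin n) ℝ) : Matrix (Fin k) (Fin k) ℝ :=
  Matrix.diagonal fun i => if 0 ≤ u₁ x ε b₁ A₁ i then 1 else 0

/-- The proposed lower bound `a₂ᵀ M A₁ x + a₂ᵀ M b₁ + b₂ - ε |a₂ᵀ M A₁| 1`. -/
def LM {n k : ℕ} (x : Fin n → ℝ) (ε : ℝ) (b₁ : Fin k → ℝ) (b₂ : ℝ)
    (A₁ : Matrix (Fin k) (Fin n) ℝ) (a₂ : Fin k → ℝ) : ℝ :=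
  (a₂ ᵥ* (M x ε b₁ A₁ * A₁)) ⬝ᵥ x + (a₂ ᵥ* M x ε b₁ A₁) ⬝ᵥ b₁ + b₂
    - ε * ∑ j, |(a₂ ᵥ* (M x ε b₁ A₁ * A₁)) j|

/-- The proposed upper bound `a₂ᵀ M A₁ x + a₂ᵀ M b₁ + b₂ + ε |a₂ᵀ M A₁| 1`. -/
def UM {n k : ℕ} (x : Fin n → ℝ) (ε : ℝ) (b₁ : Fin k → ℝ) (b₂ : ℝ)
    (A₁ : Matrix (Fin k) (Fin n) ℝ) (a₂ : Fin k → ℝ) : ℝ :=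
  (a₂ ᵥ* (M x ε b₁ A₁ * A₁)) ⬝ᵥ x + (a₂ ᵥ* M x ε b₁ A₁) ⬝ᵥ b₁ + b₂
    + ε * ∑ j, |(a₂ ᵥ* (M x ε b₁ A₁ * A₁)) j|

/-- The joint law of the weights `(A₁, a₂)`: all entries are independent, those of `A₁` are
`N(0, σA²)` and those of `a₂` are `N(0, σa²)`. The matrix `A₁` is given by its entries. -/
def weightLaw (n k : ℕ) (σA σa : ℝ≥0) : Measure ((Fin k → Fin n → ℝ) × (Fin k → ℝ)) :=
  (Measure.pi fun _ : Fin k => Measure.pi fun _ : Fin n => gaussianReal 0 (σA ^ 2)).prod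
    (Measure.pi fun _ : Fin k => gaussianReal 0 (σa ^ 2))

/-- The expectation over `(A₁, a₂)` of a function of the weights. -/
def expectW {n k : ℕ} (σA σa : ℝ≥0)
    (F : Matrix (Fin k) (Fin n) ℝ → (Fin k → ℝ) → ℝ) : ℝ :=
  ∫ w, F (Matrix.of w.1) w.2 ∂(weightLaw n k σA σa)

/-- Integrability over `(A₁, a₂)` of a function of the weights. -/
def IntegrableW {n k : ℕ} (σA σa : ℝ≥0)
    (F : Matrix (Fin k) (Fin n) ℝ → (Fin k → ℝ) → ℝ) : Prop :=
  Integrable (fun w => F (Matrix.of w.1) w.2) (weightLaw n k σA σa)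

/-- The uniform distribution on the box: normalized Lebesgue measure. -/
def uniformBox {n : ℕ} (x : Fin n → ℝ) (ε : ℝ) : Measure (Fin n → ℝ) :=
  ProbabilityTheory.cond volume (box x ε)

/-- The joint law of `((A₁, a₂), z)`, with the input `z` uniform on the box and independent of
the weights. -/
def jointLaw {n : ℕ} (k : ℕ) (σA σa : ℝ≥0) (x : Fin n → ℝ) (ε : ℝ) :
    Measure (((Fin k → Fin n → ℝ) × (Fin k → ℝ)) × (Fin n → ℝ)) :=
  (weightLaw n k σA σa).prod (uniformBox x ε)

/-- The output `g(z)` as a random variable in the weights and the input. -/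
def output {n k : ℕ} (b₁ : Fin k → ℝ) (b₂ : ℝ)
    (p : ((Fin k → Fin n → ℝ) × (Fin k → ℝ)) × (Fin n → ℝ)) : ℝ :=
  g (Matrix.of p.1.1) b₁ p.1.2 b₂ p.2

/-- `E[g(z)] - m √Var[g(z)]`, over the weights and the input. -/
def Lapprox {n k : ℕ} (σA σa : ℝ≥0) (x : Fin n → ℝ) (ε : ℝ) (b₁ : Fin k → ℝ) (b₂ : ℝ)
    (m : ℝ) : ℝ :=
  (∫ p, output b₁ b₂ p ∂(jointLaw k σA σa x ε))
    - m * √(variance (output b₁ b₂) (jointLaw k σA σa x ε))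

/-- `E[g(z)] + m √Var[g(z)]`, over the weights and the input. -/
def Uapprox {n k : ℕ} (σA σa : ℝ≥0) (x : Fin n → ℝ) (ε : ℝ) (b₁ : Fin k → ℝ) (b₂ : ℝ)
    (m : ℝ) : ℝ :=
  (∫ p, output b₁ b₂ p ∂(jointLaw k σA σa x ε))
    + m * √(variance (output b₁ b₂) (jointLaw k σA σa x ε))

/-- The key assumption: for some `m > 0`, the expected true bounds lie within `m` standard
deviations of the mean output. -/
def KeyAssumption {n k : ℕ} (σA σa : ℝ≥0) (x : Fin n → ℝ) (ε : ℝ) (b₁ : Fin k → ℝ)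
    (b₂ : ℝ) : Prop :=
  ∃ m : ℝ, 0 < m ∧
    Lapprox σA σa x ε b₁ b₂ m ≤ expectW σA σa (Ltrue x ε b₁ b₂) ∧
    expectW σA σa (Utrue x ε b₁ b₂) ≤ Uapprox σA σa x ε b₁ b₂ m

end

end ReLUBlock

/-! For fixed `A₁`, the centered Gaussian law of `a₂` is invariant under independent sign changes of
its entries, so the upper bounds may be compared after averaging over all sign patterns. On the box
the ReLU is unchanged if its argument is first masked by `M`. Hence `Utrue` is a supremum of signed
sums of ReLUs of affine functions, and `UM` is the same supremum with the ReLUs removed. ReLU is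
1-Lipschitz, so the contraction principle for Rademacher sums (`sum_sign_iSup_le`) gives the
averaged inequality `sum_flip_Utrue_le`, and integrating over the weights gives `expectW_Utrue_le`.
The substitution `a₂ ↦ -a₂` reflects everything through `b₂` and yields the lower bounds. -/

namespace ReLUBlock

/-! ### Contraction principle for Rademacher sums -/

/-- Increment domination in a single coordinate, averaged over all sign patterns. -/
theorem sum_sign_iSup_le_of_eq_off {ι κ : Type*} [Nonempty ι] [Fintype κ] [DecidableEq κ]
    (u v : ι → κ → ℝ) (l : κ) (huv : ∀ i k, k ≠ l → u i k = v i k)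
    (hl : ∀ i j, |u i l - u j l| ≤ |v i l - v j l|)
    (hv : ∀ c : κ → ℝ, BddAbove (Set.range fun i => ∑ k, c k * v i k)) (a : κ → ℝ) :
    ∑ s : κ → ℤˣ, ⨆ i, ∑ k, ((s k : ℤ) : ℝ) * a k * u i k
      ≤ ∑ s : κ → ℤˣ, ⨆ i, ∑ k, ((s k : ℤ) : ℝ) * a k * v i k := by
  -- Patterns are paired with those differing only in the sign at `l`.
  set τ : κ → ℤˣ := Pi.mulSingle l (-1) with hτ
  have hτl : τ l = -1 := by simp [hτ]
  have hτk : ∀ k, k ≠ l → τ k = 1 := fun k hk => by simp [hτ, hk]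
  have key : ∀ s : κ → ℤˣ,
      (⨆ i, ∑ k, ((s k : ℤ) : ℝ) * a k * u i k)
        + (⨆ i, ∑ k, (((τ * s) k : ℤ) : ℝ) * a k * u i k)
      ≤ (⨆ i, ∑ k, ((s k : ℤ) : ℝ) * a k * v i k)
        + ⨆ i, ∑ k, (((τ * s) k : ℤ) : ℝ) * a k * v i k := by
    intro s
    set h : ι → ℝ := fun i => ∑ k ∈ Finset.univ.erase l, ((s k : ℤ) : ℝ) * a k * v i k with hh
    set c : ℝ := ((s l : ℤ) : ℝ) * a l with hc
    have e1 : ∀ w : ι → κ → ℝ, (∀ i k, k ≠ l → w i k = v i k) → ∀ i,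
        ∑ k, ((s k : ℤ) : ℝ) * a k * w i k = h i + c * w i l := by
      intro w hw i
      rw [← Finset.sum_erase_add _ _ (Finset.mem_univ l), hh, hc]
      congr 1
      exact Finset.sum_congr rfl fun k hk => by rw [hw i k (Finset.ne_of_mem_erase hk)]
    have e2 : ∀ w : ι → κ → ℝ, (∀ i k, k ≠ l → w i k = v i k) → ∀ i,
        ∑ k, (((τ * s) k : ℤ) : ℝ) * a k * w i k = h i - c * w i l := by
      intro w hw i
      rw [← Finset.sum_erase_add _ _ (Finset.mem_univ l), hh, hc, sub_eq_add_neg]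
      congr 1
      · refine Finset.sum_congr rfl fun k hk => ?_
        have hk' := Finset.ne_of_mem_erase hk
        rw [hw i k hk', Pi.mul_apply, hτk k hk', one_mul]
      · rw [Pi.mul_apply, hτl]
        push_cast
        ring
    have b1 : BddAbove (Set.range fun i => h i + c * v i l) := by
      simpa only [e1 v fun _ _ _ => rfl] using hv fun k => ((s k : ℤ) : ℝ) * a k
    have b2 : BddAbove (Set.range fun i => h i - c * v i l) := by
      simpa only [e2 v fun _ _ _ => rfl] using hv fun k => (((τ * s) k : ℤ) : ℝ) * a k
    simp only [e1 u huv, e2 u huv, e1 v fun _ _ _ => rfl, e2 v fun _ _ _ => rfl]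
    -- For points `i`, `j` the two suprema contribute `h i + h j + c * (u i l - u j l)`. The other
    -- terms are symmetric in `i` and `j`, so exchanging the points realizes whichever sign the
    -- absolute value of the `v`-increment requires.
    refine ciSup_add_ciSup_le fun i j => ?_
    have hij : c * u i l - c * u j l ≤ |c * v i l - c * v j l| := by
      rw [← mul_sub, ← mul_sub, abs_mul]
      refine (le_abs_self _).trans ?_
      rw [abs_mul]
      exact mul_le_mul_of_nonneg_left (hl i j) (abs_nonneg c)
    rcases abs_cases (c * v i l - c * v j l) with ⟨h1, -⟩ | ⟨h1, -⟩
    · linarith [le_ciSup b1 i, le_ciSup b2 j]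
    · linarith [le_ciSup b1 j, le_ciSup b2 i]
  -- Translation by `τ` is a bijection, so summing the pairs counts every pattern twice.
  have re : ∀ F : (κ → ℤˣ) → ℝ, ∑ s, F (τ * s) = ∑ s, F s := fun F =>
    Equiv.sum_comp (Equiv.mulLeft τ) F
  have := Finset.sum_le_sum fun s (_ : s ∈ Finset.univ) => key s
  rw [Finset.sum_add_distrib, Finset.sum_add_distrib,
    re fun s => ⨆ i, ∑ k, ((s k : ℤ) : ℝ) * a k * u i k,
    re fun s => ⨆ i, ∑ k, ((s k : ℤ) : ℝ) * a k * v i k] at this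
  linarith

/-- The contraction principle: if the coordinate increments of `u` are dominated by those of `v`,
then the suprema of the signed sums of `u` are on average at most those of `v`. -/
theorem sum_sign_iSup_le {ι κ : Type*} [Nonempty ι] [Fintype κ] [DecidableEq κ]
    (u v : ι → κ → ℝ) (huv : ∀ k i j, |u i k - u j k| ≤ |v i k - v j k|)
    (hu : ∀ k, ∃ C, ∀ i, |u i k| ≤ C) (hv : ∀ k, ∃ C, ∀ i, |v i k| ≤ C) (a : κ → ℝ) :
    ∑ s : κ → ℤˣ, ⨆ i, ∑ k, ((s k : ℤ) : ℝ) * a k * u i k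
      ≤ ∑ s : κ → ℤˣ, ⨆ i, ∑ k, ((s k : ℤ) : ℝ) * a k * v i k := by
  choose Cu hCu using hu
  choose Cv hCv using hv
  -- Hybrid argument: the coordinates of `u` are replaced by those of `v` one at a time.
  have main : ∀ S : Finset κ,
      ∑ s : κ → ℤˣ, ⨆ i, ∑ k, ((s k : ℤ) : ℝ) * a k * u i k
        ≤ ∑ s : κ → ℤˣ, ⨆ i, ∑ k, ((s k : ℤ) : ℝ) * a k * (if k ∈ S then v i k else u i k) := by
    intro S
    induction S using Finset.induction_on with
    | empty => simp
    | insert l S hlS ih =>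
      refine ih.trans (sum_sign_iSup_le_of_eq_off _ _ l ?_ ?_ ?_ a)
      · intro i k hk
        simp [Finset.mem_insert, hk]
      · intro i j
        simpa [hlS] using huv l i j
      · intro c
        refine ⟨∑ k, |c k| * max (Cu k) (Cv k), ?_⟩
        rintro _ ⟨i, rfl⟩
        refine Finset.sum_le_sum fun k _ => (le_abs_self _).trans ?_
        rw [abs_mul]
        refine mul_le_mul_of_nonneg_left ?_ (abs_nonneg _)
        split_ifs
        · exact (hCv k i).trans (le_max_right _ _)
        · exact (hCu k i).trans (le_max_left _ _)
  simpa using main Finset.univ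

/-! ### Both upper bounds as suprema over the box, for fixed weights -/

section Deterministic

variable {n k : ℕ} (x : Fin n → ℝ) {ε : ℝ} (b₁ : Fin k → ℝ) (b₂ : ℝ)
  (A₁ : Matrix (Fin k) (Fin n) ℝ) (a₂ : Fin k → ℝ)

theorem abs_sub_le_of_mem_box {x z : Fin n → ℝ} (hz : z ∈ box x ε) (j : Fin n) :
    |z j - x j| ≤ ε := by
  have h1 := hz.1 j
  have h2 := hz.2 j
  simp only at h1 h2
  exact abs_le.2 ⟨by linarith, by linarith⟩

theorem mem_box_self (hε : 0 < ε) : x ∈ box x ε :=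
  ⟨fun j => by simp only; linarith, fun j => by simp only; linarith⟩

/-- The pre-activation after masking by `M`. -/
noncomputable def masked (ε : ℝ) (z : Fin n → ℝ) (i : Fin k) : ℝ :=
  (if 0 ≤ u₁ x ε b₁ A₁ i then 1 else 0) * (A₁ *ᵥ z + b₁) i

theorem u₁_apply (i : Fin k) :
    u₁ x ε b₁ A₁ i = ∑ j, A₁ i j * x j + b₁ i + ε * ∑ j, |A₁ i j| := by
  simp [u₁, Matrix.mulVec, dotProduct]

theorem preactivation_le_u₁ {z : Fin n → ℝ} (hz : z ∈ box x ε) (i : Fin k) :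
    (A₁ *ᵥ z + b₁) i ≤ u₁ x ε b₁ A₁ i := by
  rw [u₁_apply]
  have : ∑ j, A₁ i j * z j ≤ ∑ j, A₁ i j * x j + ε * ∑ j, |A₁ i j| := by
    rw [Finset.mul_sum, ← Finset.sum_add_distrib]
    refine Finset.sum_le_sum fun j _ => ?_
    have h := (le_abs_self (A₁ i j * (z j - x j))).trans_eq (abs_mul _ _)
    have h' := mul_le_mul_of_nonneg_left (abs_sub_le_of_mem_box hz j) (abs_nonneg (A₁ i j))
    linarith
  simp only [Pi.add_apply, Matrix.mulVec, dotProduct]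
  linarith

/-- A masked row has `u₁ < 0`, so its preactivation is negative on the whole box and its ReLU
already vanishes there. -/
theorem relu_eq_relu_masked {z : Fin n → ℝ} (hz : z ∈ box x ε) (i : Fin k) :
    max ((A₁ *ᵥ z + b₁) i) 0 = max (masked x b₁ A₁ ε z i) 0 := by
  unfold masked
  split_ifs with h
  · rw [one_mul]
  · rw [zero_mul, max_self, max_eq_right]
    exact (preactivation_le_u₁ x b₁ A₁ hz i).trans (not_le.1 h).le

/-- A bound for the preactivations on the box. -/
noncomputable def preBound (ε : ℝ) (i : Fin k) : ℝ :=
  ∑ j, |A₁ i j| * (|x j| + ε) + |b₁ i|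

theorem abs_preactivation_le {z : Fin n → ℝ} (hz : z ∈ box x ε) (i : Fin k) :
    |(A₁ *ᵥ z + b₁) i| ≤ preBound x b₁ A₁ ε i := by
  simp only [Pi.add_apply, Matrix.mulVec, dotProduct, preBound]
  refine (abs_add_le _ _).trans (add_le_add_left ?_ _)
  refine (Finset.abs_sum_le_sum_abs _ _).trans (Finset.sum_le_sum fun j _ => ?_)
  rw [abs_mul]
  refine mul_le_mul_of_nonneg_left ?_ (abs_nonneg _)
  have := abs_sub_le_of_mem_box hz j
  have h2 := abs_add_le (z j - x j) (x j)
  rw [sub_add_cancel] at h2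
  linarith

theorem abs_masked_le {z : Fin n → ℝ} (hz : z ∈ box x ε) (i : Fin k) :
    |masked x b₁ A₁ ε z i| ≤ preBound x b₁ A₁ ε i := by
  refine le_trans ?_ (abs_preactivation_le x b₁ A₁ hz i)
  unfold masked
  split_ifs <;> simp

theorem abs_relu_le {t C : ℝ} (h : |t| ≤ C) : |max t 0| ≤ C :=
  abs_le.2 ⟨(abs_le.1 h).1.trans (le_max_left _ _),
    max_le (abs_le.1 h).2 ((abs_nonneg t).trans h)⟩

theorem abs_g_le {z : Fin n → ℝ} (hz : z ∈ box x ε) :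
    |g A₁ b₁ a₂ b₂ z| ≤ ∑ i, |a₂ i| * preBound x b₁ A₁ ε i + |b₂| := by
  refine (abs_add_le _ _).trans (add_le_add_left ?_ _)
  refine (Finset.abs_sum_le_sum_abs _ _).trans (Finset.sum_le_sum fun i _ => ?_)
  rw [abs_mul]
  exact mul_le_mul_of_nonneg_left (abs_relu_le (abs_preactivation_le x b₁ A₁ hz i))
    (abs_nonneg _)

theorem abs_Utrue_le (hε : 0 < ε) :
    |Utrue x ε b₁ b₂ A₁ a₂| ≤ ∑ i, |a₂ i| * preBound x b₁ A₁ ε i + |b₂| := by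
  have hb : ∀ y ∈ g A₁ b₁ a₂ b₂ '' box x ε,
      |y| ≤ ∑ i, |a₂ i| * preBound x b₁ A₁ ε i + |b₂| := by
    rintro _ ⟨z, hz, rfl⟩
    exact abs_g_le x b₁ b₂ A₁ a₂ hz
  have hx : g A₁ b₁ a₂ b₂ x ∈ g A₁ b₁ a₂ b₂ '' box x ε := ⟨x, mem_box_self x hε, rfl⟩
  refine abs_le.2 ⟨(abs_le.1 (hb _ hx)).1.trans (le_csSup ⟨_, fun y hy => (abs_le.1 (hb y hy)).2⟩ hx),
    csSup_le ⟨_, hx⟩ fun y hy => (abs_le.1 (hb y hy)).2⟩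

theorem vecMul_M_mul (j : Fin n) :
    (a₂ ᵥ* (M x ε b₁ A₁ * A₁)) j
      = ∑ i, a₂ i * ((if 0 ≤ u₁ x ε b₁ A₁ i then 1 else 0) * A₁ i j) := by
  simp [Matrix.vecMul, dotProduct, M, Matrix.diagonal_mul]

/-- The masked network is affine in the input. -/
theorem sum_masked_eq (z : Fin n → ℝ) :
    ∑ i, a₂ i * masked x b₁ A₁ ε z i
      = (a₂ ᵥ* (M x ε b₁ A₁ * A₁)) ⬝ᵥ z + (a₂ ᵥ* M x ε b₁ A₁) ⬝ᵥ b₁ := by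
  rw [← Matrix.dotProduct_mulVec, ← Matrix.dotProduct_mulVec, ← dotProduct_add,
    ← Matrix.mulVec_mulVec, ← Matrix.mulVec_add]
  simp [dotProduct, masked, M, Matrix.mulVec_diagonal]

theorem sum_masked_le_UM {z : Fin n → ℝ} (hz : z ∈ box x ε) :
    ∑ i, a₂ i * masked x b₁ A₁ ε z i + b₂ ≤ UM x ε b₁ b₂ A₁ a₂ := by
  rw [sum_masked_eq, UM]
  set c := a₂ ᵥ* (M x ε b₁ A₁ * A₁)
  have : c ⬝ᵥ z ≤ c ⬝ᵥ x + ε * ∑ j, |c j| := by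
    rw [dotProduct, dotProduct, Finset.mul_sum, ← Finset.sum_add_distrib]
    refine Finset.sum_le_sum fun j _ => ?_
    have h := (le_abs_self (c j * (z j - x j))).trans_eq (abs_mul _ _)
    have h' := mul_le_mul_of_nonneg_left (abs_sub_le_of_mem_box hz j) (abs_nonneg (c j))
    linarith
  linarith

theorem exists_UM_eq (hε : 0 < ε) :
    ∃ z ∈ box x ε, UM x ε b₁ b₂ A₁ a₂ = ∑ i, a₂ i * masked x b₁ A₁ ε z i + b₂ := by
  set c := a₂ ᵥ* (M x ε b₁ A₁ * A₁) with hc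
  -- The corner of the box that maximizes the linear form `c`.
  refine ⟨fun j => x j + if 0 ≤ c j then ε else -ε, ⟨fun j => ?_, fun j => ?_⟩, ?_⟩
  · simp only
    split_ifs <;> linarith
  · simp only
    split_ifs <;> linarith
  · rw [sum_masked_eq, UM, ← hc]
    have : c ⬝ᵥ (fun j => x j + if 0 ≤ c j then ε else -ε) = c ⬝ᵥ x + ε * ∑ j, |c j| := by
      rw [dotProduct, dotProduct, Finset.mul_sum, ← Finset.sum_add_distrib]
      refine Finset.sum_congr rfl fun j _ => ?_
      split_ifs with h
      · rw [abs_of_nonneg h]; ring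
      · rw [abs_of_neg (not_le.1 h)]; ring
    rw [this]
    ring

theorem abs_UM_le (hε : 0 < ε) :
    |UM x ε b₁ b₂ A₁ a₂| ≤ ∑ i, |a₂ i| * preBound x b₁ A₁ ε i + |b₂| := by
  obtain ⟨z, hz, h⟩ := exists_UM_eq x b₁ b₂ A₁ a₂ hε
  rw [h]
  refine (abs_add_le _ _).trans (add_le_add_left ?_ _)
  refine (Finset.abs_sum_le_sum_abs _ _).trans (Finset.sum_le_sum fun i _ => ?_)
  rw [abs_mul]
  exact mul_le_mul_of_nonneg_left (abs_masked_le x b₁ A₁ hz i) (abs_nonneg _)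

theorem bddAbove_range_sum {u : box x ε → Fin k → ℝ} {C : Fin k → ℝ}
    (hu : ∀ z i, |u z i| ≤ C i) : BddAbove (Set.range fun z => ∑ i, a₂ i * u z i) := by
  refine ⟨∑ i, |a₂ i| * C i, ?_⟩
  rintro _ ⟨z, rfl⟩
  refine Finset.sum_le_sum fun i _ => (le_abs_self _).trans ?_
  rw [abs_mul]
  exact mul_le_mul_of_nonneg_left (hu z i) (abs_nonneg _)

theorem Utrue_eq_iSup (hε : 0 < ε) :
    Utrue x ε b₁ b₂ A₁ a₂
      = (⨆ z : box x ε, ∑ i, a₂ i * max (masked x b₁ A₁ ε z i) 0) + b₂ := by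
  have : Nonempty (box x ε) := ⟨⟨x, mem_box_self x hε⟩⟩
  rw [Utrue, sSup_image', ciSup_add (bddAbove_range_sum x a₂ fun z i =>
    abs_relu_le (abs_masked_le x b₁ A₁ z.2 i))]
  refine iSup_congr fun z => ?_
  simp only [g, dotProduct, relu_eq_relu_masked x b₁ A₁ z.2]

/-- The interval bound of a single affine function is attained at a corner, hence exact. -/
theorem UM_eq_iSup (hε : 0 < ε) :
    UM x ε b₁ b₂ A₁ a₂ = (⨆ z : box x ε, ∑ i, a₂ i * masked x b₁ A₁ ε z i) + b₂ := by
  have : Nonempty (box x ε) := ⟨⟨x, mem_box_self x hε⟩⟩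
  have hb := bddAbove_range_sum x a₂ fun z : box x ε => abs_masked_le x b₁ A₁ z.2
  refine le_antisymm ?_ ?_
  · obtain ⟨z, hz, h⟩ := exists_UM_eq x b₁ b₂ A₁ a₂ hε
    rw [h]
    exact add_le_add_left (le_ciSup hb ⟨z, hz⟩) _
  · rw [ciSup_add hb]
    exact ciSup_le fun z => sum_masked_le_UM x b₁ b₂ A₁ a₂ z.2

/-- Multiplication of a vector by a sign pattern. -/
def flip (s : Fin k → ℤˣ) (a : Fin k → ℝ) : Fin k → ℝ := fun i => ((s i : ℤ) : ℝ) * a i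

/-- `M` depends on `A₁` only, so sign changes of `a₂` leave the masked preactivations fixed and the
contraction principle applies to them. -/
theorem sum_flip_Utrue_le (hε : 0 < ε) :
    ∑ s : Fin k → ℤˣ, Utrue x ε b₁ b₂ A₁ (flip s a₂)
      ≤ ∑ s : Fin k → ℤˣ, UM x ε b₁ b₂ A₁ (flip s a₂) := by
  have : Nonempty (box x ε) := ⟨⟨x, mem_box_self x hε⟩⟩
  simp only [Utrue_eq_iSup x b₁ b₂ A₁ _ hε, UM_eq_iSup x b₁ b₂ A₁ _ hε, Finset.sum_add_distrib]
  refine add_le_add_left (sum_sign_iSup_le (fun (z : box x ε) i => max (masked x b₁ A₁ ε z i) 0)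
    (fun z i => masked x b₁ A₁ ε z i) (fun i z w => ?_) (fun i => ⟨_, fun z => abs_relu_le (abs_masked_le x b₁ A₁ z.2 i)⟩)
    (fun i => ⟨_, fun z => abs_masked_le x b₁ A₁ z.2 i⟩) a₂) _
  exact abs_max_sub_max_le_abs _ _ _

theorem g_neg (z : Fin n → ℝ) : g A₁ b₁ (-a₂) b₂ z = 2 * b₂ - g A₁ b₁ a₂ b₂ z := by
  simp only [g, neg_dotProduct]
  ring

theorem Ltrue_eq (hε : 0 < ε) :
    Ltrue x ε b₁ b₂ A₁ a₂ = 2 * b₂ - Utrue x ε b₁ b₂ A₁ (-a₂) := by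
  have hne : (g A₁ b₁ a₂ b₂ '' box x ε).Nonempty := ⟨_, x, mem_box_self x hε, rfl⟩
  have hne' : (g A₁ b₁ (-a₂) b₂ '' box x ε).Nonempty := ⟨_, x, mem_box_self x hε, rfl⟩
  have hb : BddBelow (g A₁ b₁ a₂ b₂ '' box x ε) :=
    ⟨-(∑ i, |a₂ i| * preBound x b₁ A₁ ε i + |b₂|), by
      rintro _ ⟨z, hz, rfl⟩
      exact (abs_le.1 (abs_g_le x b₁ b₂ A₁ a₂ hz)).1⟩
  have hb' : BddAbove (g A₁ b₁ (-a₂) b₂ '' box x ε) :=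
    ⟨∑ i, |(-a₂) i| * preBound x b₁ A₁ ε i + |b₂|, by
      rintro _ ⟨z, hz, rfl⟩
      exact (abs_le.1 (abs_g_le x b₁ b₂ A₁ (-a₂) hz)).2⟩
  refine le_antisymm ?_ ?_
  · rw [le_sub_comm]
    refine csSup_le hne' ?_
    rintro _ ⟨z, hz, rfl⟩
    have := csInf_le hb ⟨z, hz, rfl⟩
    rw [g_neg, Ltrue]
    linarith
  · refine le_csInf hne ?_
    rintro _ ⟨z, hz, rfl⟩
    have := le_csSup hb' ⟨z, hz, rfl⟩
    rw [g_neg] at this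
    rw [Utrue]
    linarith

theorem LM_eq : LM x ε b₁ b₂ A₁ a₂ = 2 * b₂ - UM x ε b₁ b₂ A₁ (-a₂) := by
  simp only [LM, UM, Matrix.neg_vecMul, neg_dotProduct, Pi.neg_apply, abs_neg]
  ring

end Deterministic

/-! ### Sign symmetry and integrability under the Gaussian law -/

section Law

variable {n k : ℕ} (σA σa : ℝ≥0)

instance : IsProbabilityMeasure (weightLaw n k σA σa) := by
  unfold weightLaw
  infer_instance

theorem integrable_id_gaussianReal (σ : ℝ≥0) :
    Integrable (fun t : ℝ => t) (gaussianReal 0 σ) :=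
  (memLp_id_gaussianReal 1).integrable le_rfl

theorem measurePreserving_sign_gaussianReal (s : ℤˣ) (v : ℝ≥0) :
    MeasurePreserving (fun t : ℝ => ((s : ℤ) : ℝ) * t) (gaussianReal 0 v) (gaussianReal 0 v) := by
  refine ⟨by fun_prop, ?_⟩
  rw [gaussianReal_map_const_mul, mul_zero]
  congr 1
  rcases Int.units_eq_one_or s with rfl | rfl <;> ext <;> simp

/-- The law of the weights is invariant under sign changes of the outer weights. -/
theorem measurePreserving_flip (s : Fin k → ℤˣ) :
    MeasurePreserving (fun w : (Fin k → Fin n → ℝ) × (Fin k → ℝ) => (w.1, flip s w.2))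
      (weightLaw n k σA σa) (weightLaw n k σA σa) :=
  (MeasurePreserving.id _).prod (measurePreserving_pi _ _ fun i =>
    measurePreserving_sign_gaussianReal (s i) _)

theorem flip_neg_one (a : Fin k → ℝ) : flip (fun _ => -1) a = -a := by
  ext i
  simp [flip]

theorem integrableW_flip {F : Matrix (Fin k) (Fin n) ℝ → (Fin k → ℝ) → ℝ}
    (hF : IntegrableW σA σa F) (s : Fin k → ℤˣ) :
    IntegrableW σA σa fun A a => F A (flip s a) :=
  (measurePreserving_flip σA σa s).integrable_comp_of_integrable hF

theorem expectW_flip {F : Matrix (Fin k) (Fin n) ℝ → (Fin k → ℝ) → ℝ}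
    (hF : IntegrableW σA σa F) (s : Fin k → ℤˣ) :
    expectW σA σa (fun A a => F A (flip s a)) = expectW σA σa F := by
  have h := measurePreserving_flip (n := n) σA σa s
  have := integral_map h.measurable.aemeasurable (h.map_eq.symm ▸ hF.aestronglyMeasurable)
  rw [h.map_eq] at this
  exact this.symm

theorem integrable_entries (i : Fin k) (j : Fin n) :
    Integrable (fun w : (Fin k → Fin n → ℝ) × (Fin k → ℝ) => |w.1 i j| * |w.2 i|)
      (weightLaw n k σA σa) := by
  refine Integrable.mul_prod (f := fun A : Fin k → Fin n → ℝ => |A i j|)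
    (g := fun a : Fin k → ℝ => |a i|) ?_ ?_
  · have h1 := measurePreserving_eval
      (fun _ : Fin k => Measure.pi fun _ : Fin n => gaussianReal 0 (σA ^ 2)) i
    have h2 := measurePreserving_eval (fun _ : Fin n => gaussianReal 0 (σA ^ 2)) j
    exact ((h2.comp h1).integrable_comp_of_integrable (integrable_id_gaussianReal _)).abs
  · exact ((measurePreserving_eval (fun _ : Fin k => gaussianReal 0 (σa ^ 2))
      i).integrable_comp_of_integrable (integrable_id_gaussianReal _)).abs

theorem integrable_outer (i : Fin k) :
    Integrable (fun w : (Fin k → Fin n → ℝ) × (Fin k → ℝ) => |w.2 i|)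
      (weightLaw n k σA σa) :=
  Integrable.comp_snd (f := fun a : Fin k → ℝ => |a i|)
    ((measurePreserving_eval (fun _ : Fin k => gaussianReal 0 (σa ^ 2))
      i).integrable_comp_of_integrable (integrable_id_gaussianReal _)).abs _

variable (x : Fin n → ℝ) {ε : ℝ} (b₁ : Fin k → ℝ) (b₂ : ℝ)

/-- The common dominating function for `Utrue` and `UM`; independence makes each product `|A i j| *
|a i|` integrable. -/
theorem integrableW_bound :
    IntegrableW σA σa fun A a => ∑ i, |a i| * preBound x b₁ A ε i + |b₂| := by
  refine (integrable_finsetSum _ fun i _ => ?_).add (integrable_const _)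
  have : Integrable (fun w : (Fin k → Fin n → ℝ) × (Fin k → ℝ) =>
      ∑ j, (|w.1 i j| * |w.2 i|) * (|x j| + ε) + |w.2 i| * |b₁ i|) (weightLaw n k σA σa) :=
    (integrable_finsetSum _ fun j _ => (integrable_entries σA σa i j).mul_const _).add
      ((integrable_outer σA σa i).mul_const _)
  refine this.congr (Filter.Eventually.of_forall fun w => ?_)
  simp only [preBound, Matrix.of_apply, mul_add, Finset.mul_sum]
  congr 1
  exact Finset.sum_congr rfl fun j _ => by ring

theorem integrableW_Utrue (hε : 0 < ε) : IntegrableW σA σa (Utrue x ε b₁ b₂) := by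
  refine Integrable.mono' (integrableW_bound σA σa x b₁ b₂ (ε := ε)) ?_
    (Filter.Eventually.of_forall fun w => abs_Utrue_le x b₁ b₂ _ _ hε)
  -- A supremum over a compact set of a jointly continuous function is continuous in the parameters.
  refine Continuous.aestronglyMeasurable ?_
  refine IsCompact.continuous_sSup (f := fun w : (Fin k → Fin n → ℝ) × (Fin k → ℝ) =>
    g (Matrix.of w.1) b₁ w.2 b₂) (K := box x ε) isCompact_Icc ?_
  simp only [Function.HasUncurry.uncurry, g, dotProduct, Matrix.mulVec, Pi.add_apply,
    Matrix.of_apply, id]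
  fun_prop

theorem integrableW_UM (hε : 0 < ε) : IntegrableW σA σa (UM x ε b₁ b₂) := by
  refine Integrable.mono' (integrableW_bound σA σa x b₁ b₂ (ε := ε)) ?_
    (Filter.Eventually.of_forall fun w => abs_UM_le x b₁ b₂ _ _ hε)
  -- The mask can jump as `A₁` varies, so measurability is checked directly instead of through
  -- continuity.
  refine Measurable.aestronglyMeasurable ?_
  have hM : ∀ i : Fin k, Measurable fun w : (Fin k → Fin n → ℝ) × (Fin k → ℝ) =>
      if 0 ≤ u₁ x ε b₁ (Matrix.of w.1) i then (1 : ℝ) else 0 := by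
    intro i
    refine Measurable.ite (measurableSet_le measurable_const ?_) measurable_const measurable_const
    simp only [u₁_apply, Matrix.of_apply]
    fun_prop
  have hc : ∀ j : Fin n, Measurable fun w : (Fin k → Fin n → ℝ) × (Fin k → ℝ) =>
      (w.2 ᵥ* (M x ε b₁ (Matrix.of w.1) * Matrix.of w.1)) j := by
    intro j
    simp only [vecMul_M_mul, Matrix.of_apply]
    fun_prop
  have hd : Measurable fun w : (Fin k → Fin n → ℝ) × (Fin k → ℝ) =>
      (w.2 ᵥ* M x ε b₁ (Matrix.of w.1)) ⬝ᵥ b₁ := by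
    simp only [M, Matrix.vecMul_diagonal, dotProduct]
    fun_prop
  simp only [UM, dotProduct] at hd ⊢
  fun_prop

/-- By invariance every sign pattern contributes the same expectation; the number of patterns then
cancels from the averaged inequality. -/
theorem expectW_Utrue_le (hε : 0 < ε) :
    expectW σA σa (Utrue x ε b₁ b₂) ≤ expectW σA σa (UM x ε b₁ b₂) := by
  have hU := integrableW_Utrue σA σa x b₁ b₂ hε
  have hM := integrableW_UM σA σa x b₁ b₂ hε
  have sum_eq : ∀ F : Matrix (Fin k) (Fin n) ℝ → (Fin k → ℝ) → ℝ, IntegrableW σA σa F →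
      expectW σA σa (fun A a => ∑ s : Fin k → ℤˣ, F A (flip s a))
        = Fintype.card (Fin k → ℤˣ) * expectW σA σa F := by
    intro F hF
    have : expectW σA σa (fun A a => ∑ s : Fin k → ℤˣ, F A (flip s a))
        = ∑ s : Fin k → ℤˣ, expectW σA σa (fun A a => F A (flip s a)) :=
      integral_finsetSum _ fun s _ => integrableW_flip σA σa hF s
    simp only [this, expectW_flip σA σa hF, Finset.sum_const, Finset.card_univ, nsmul_eq_mul]
  have hle : expectW σA σa (fun A a => ∑ s : Fin k → ℤˣ, Utrue x ε b₁ b₂ A (flip s a))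
      ≤ expectW σA σa (fun A a => ∑ s : Fin k → ℤˣ, UM x ε b₁ b₂ A (flip s a)) :=
    integral_mono (integrable_finsetSum _ fun s _ => integrableW_flip σA σa hU s)
      (integrable_finsetSum _ fun s _ => integrableW_flip σA σa hM s)
      fun w => sum_flip_Utrue_le x b₁ b₂ _ _ hε
  rw [sum_eq _ hU, sum_eq _ hM] at hle
  exact le_of_mul_le_mul_left hle (by exact_mod_cast Fintype.card_pos)

/-- Reflection of a bound through `b₂` together with a sign change of the outer weights. -/
theorem integrableW_reflect {F G : Matrix (Fin k) (Fin n) ℝ → (Fin k → ℝ) → ℝ}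
    (hF : IntegrableW σA σa F) (hG : ∀ A a, G A a = 2 * b₂ - F A (-a)) :
    IntegrableW σA σa G ∧ expectW σA σa G = 2 * b₂ - expectW σA σa F := by
  have hG' : G = fun A a => 2 * b₂ - F A (flip (fun _ => -1) a) := by
    funext A a
    rw [hG, flip_neg_one]
  have hi := integrableW_flip σA σa hF fun _ => -1
  subst hG'
  refine ⟨(integrable_const _).sub hi, ?_⟩
  refine (integral_sub (integrable_const (2 * b₂)) hi).trans ?_
  rw [← expectW_flip σA σa hF fun _ => -1]
  simp [expectW]

end Law

end ReLUBlock

theorem theorem1 :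
    ∃ N : ℕ, ∀ n : ℕ, N ≤ n →
      ∀ (k : ℕ) (σA σa : ℝ≥0), 0 < σA → 0 < σa →
      ∀ (x : Fin n → ℝ) (ε : ℝ), 0 < ε →
      ∀ (b₁ : Fin k → ℝ) (b₂ : ℝ),
        ReLUBlock.KeyAssumption σA σa x ε b₁ b₂ →
          (ReLUBlock.IntegrableW σA σa (ReLUBlock.LM x ε b₁ b₂) ∧
            ReLUBlock.IntegrableW σA σa (ReLUBlock.Ltrue x ε b₁ b₂) ∧
            ReLUBlock.expectW σA σa (ReLUBlock.LM x ε b₁ b₂)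
              ≤ ReLUBlock.expectW σA σa (ReLUBlock.Ltrue x ε b₁ b₂)) ∧
          (ReLUBlock.IntegrableW σA σa (ReLUBlock.Utrue x ε b₁ b₂) ∧
            ReLUBlock.IntegrableW σA σa (ReLUBlock.UM x ε b₁ b₂) ∧
            ReLUBlock.expectW σA σa (ReLUBlock.Utrue x ε b₁ b₂)
              ≤ ReLUBlock.expectW σA σa (ReLUBlock.UM x ε b₁ b₂)) := by
  -- The contraction argument works in every input dimension, so the threshold is `0`.
  refine ⟨0, fun n _ k σA σa _ _ x ε hε b₁ b₂ _ => ?_⟩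
  have hU := ReLUBlock.integrableW_Utrue σA σa x b₁ b₂ hε
  have hM := ReLUBlock.integrableW_UM σA σa x b₁ b₂ hε
  have hle := ReLUBlock.expectW_Utrue_le σA σa x b₁ b₂ hε
  obtain ⟨hL, hLe⟩ := ReLUBlock.integrableW_reflect σA σa b₂ hU
    fun A a => ReLUBlock.Ltrue_eq x b₁ b₂ A a hε
  obtain ⟨hN, hNe⟩ := ReLUBlock.integrableW_reflect σA σa b₂ hM
    fun A a => ReLUBlock.LM_eq x b₁ b₂ A a
  exact ⟨⟨hN, hL, by rw [hLe, hNe]; linarith⟩, hU, hM, hle⟩
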